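/- For $0<k<1$ and an integer $m\ge 2$ let $B_m=B_{m,k}$ be the $m\times m$ matrix $$B_m(x,y)=\frac1{m^2}\Bigl(1-k\cos\bigl(2\pi\tfrac{(x-1)+(y-1)}{m}\bigr)\Bigr),\qquad x,y\in\{1,\dots,m\},$$ which for $m\ge3$ is $1/m^2$ times the slack matrix of two concentric regular $m$-gons (the outer one with inscribed circle of radius $1$, the inner one with circumscribed circle of radius $k$). For a correlation $P$ (a joint probability distribution on $[n]\times[n]$), let $\mathrm R(P)$ be the least value of $\lceil\log_2 d\rceil$ such that $P$ can be obtained from a probability distribution on $[d]\times[d]$ by stochastic maps applied locally to the two coordinates. For $0\le\lambda\le1$ let $\mathcal E_\lambda(\rho)=(1-\lambda)\rho+\lambda\operatorname{tr}(\rho)I_d/d$. A density operator $\sigma$ on $\mathbb C^d\otimes\mathbb C^d$ generates $P$ under noise $\lambda$ if there are POVMs $\{E_x\},\{F_y\}$ on $\mathbb C^d$ with $P(x,y)=\operatorname{tr}\bigl((E_x\otimes F_y)\,(\mathcal E_\lambda\otimes\mathcal E_\lambda)(\sigma)\bigr)$ for all $x,y$; $P$ is reachable under noise $\lambda$ if some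 such $d,\sigma$ exist. The quantum advantage is $$\mathcal S_\lambda(P)=\frac{\mathrm R(P)}{\inf_\sigma\lceil\log_2 d\rceil},$$ the infimum being over all $d$ and all $\sigma$ on $\mathbb C^d\otimes\mathbb C^d$ that generate $P$ under noise $\lambda$, and $\infty$ (so that $\mathcal S_\lambda(P)=0$) if there are none. An $r\times r$ $\mathcal E_\lambda$-PSD factorization of $P$ consists of positive semidefinite $C_x,D_y\in\mathbb C^{r\times r}$ with $P(x,y)=\operatorname{tr}(C_xD_y)$, with $C=\sum_aC_a$ and $D=\sum_bD_b$ invertible, such that all $C_x-\frac\lambda r\operatorname{tr}(C_xC^{-1})\,C$ and $D_y-\frac\lambda r\operatorname{tr}(D_yD^{-1})\,D$ are positive semidefinite. **Theorem.** 1. For all $0<k<1$ and $m\ge2$, $B_m$ is a correlation, and for every $0\le\lambda\le1-\sqrt k$ it has a $2\times2$ $\mathcal E_\lambda$-PSD factorization, it is reachable under noise $\lambda$, and $\mathcal S_\lambda(B_m)=\mathrm R(B_m)$, independently of $\lambda$. 2. There is an absolute constant $c>0$ such that $\mathcal S_\lambda(B_m)\ge c\log\log m$ for all $m\ge3$, all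 $0<k<1$ with $k>\frac{\cos(2\pi/m)}{\cos^2(\pi/m)}$, and all $0\le\lambda\le1-\sqrt k$. 3. For all $0<k<1$, $m\ge2$ and $1-\sqrt k<\lambda\le1$, $B_m$ is not reachable under noise $\lambda$, and $\mathcal S_\lambda(B_m)=0$. -/

import Mathlib

open scoped Kronecker ENNReal ComplexOrder

noncomputable section

namespace CorrelationGeneration

/-- A classical correlation: a joint probability distribution of two outcomes in `Fin n`. -/
structure IsCorrelation {n : ℕ} (P : Matrix (Fin n) (Fin n) ℝ) : Prop where
  nonneg : ∀ x y, 0 ≤ P x y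
  sum_eq_one : ∑ x, ∑ y, P x y = 1

/-- A local classical operation: `K i x` is the probability of output `x` on input `i`. -/
structure IsStochastic {d n : ℕ} (K : Matrix (Fin d) (Fin n) ℝ) : Prop where
  nonneg : ∀ i x, 0 ≤ K i x
  sum_eq_one : ∀ i, ∑ x, K i x = 1

/-- The seed correlation `P'` generates `P` by local classical operations. -/
def ClassicallyGenerates {d n : ℕ} (P' : Matrix (Fin d) (Fin d) ℝ)
    (P : Matrix (Fin n) (Fin n) ℝ) : Prop :=
  ∃ K L : Matrix (Fin d) (Fin n) ℝ, IsStochastic K ∧ IsStochastic L ∧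
    ∀ x y, P x y = ∑ i, ∑ j, P' i j * K i x * L j y

/-- The size of a bipartite seed of local dimension `d`, that is, half of the total number of
(qu)bits needed to record it: `⌈log₂ d⌉` on each side. -/
def seedSize (d : ℕ) : ℝ≥0∞ := (Nat.clog 2 d : ℝ≥0∞)

/-- The classical correlation complexity `R(P)`: the least size of a seed correlation that
generates `P`. -/
def classicalComplexity {n : ℕ} (P : Matrix (Fin n) (Fin n) ℝ) : ℝ≥0∞ :=
  ⨅ (d : ℕ) (P' : Matrix (Fin d) (Fin d) ℝ) (_ : IsCorrelation P')
    (_ : ClassicallyGenerates P' P), seedSize d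

/-- Density operators on `ℂ^d ⊗ ℂ^d`. -/
structure IsBipartiteState {d : ℕ} (σ : Matrix (Fin d × Fin d) (Fin d × Fin d) ℂ) : Prop where
  posSemidef : σ.PosSemidef
  trace_eq_one : σ.trace = 1

/-- A POVM on `ℂ^d` with outcomes in `Fin n`. -/
structure IsPOVM {d n : ℕ} (E : Fin n → Matrix (Fin d) (Fin d) ℂ) : Prop where
  posSemidef : ∀ x, (E x).PosSemidef
  sum_eq_one : ∑ x, E x = 1

/-- The depolarizing channel `ρ ↦ (1 - lam) ρ + lam tr(ρ) I / d`. -/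
def depolarize (lam : ℝ) {d : ℕ} (ρ : Matrix (Fin d) (Fin d) ℂ) : Matrix (Fin d) (Fin d) ℂ :=
  (1 - lam : ℂ) • ρ + ((lam : ℂ) * ρ.trace / (d : ℂ)) • (1 : Matrix (Fin d) (Fin d) ℂ)

/-- `Φ ⊗ id`: the map `Φ` applied to the first tensor factor. -/
def onFirst {d : ℕ} (Φ : Matrix (Fin d) (Fin d) ℂ → Matrix (Fin d) (Fin d) ℂ)
    (σ : Matrix (Fin d × Fin d) (Fin d × Fin d) ℂ) :
    Matrix (Fin d × Fin d) (Fin d × Fin d) ℂ :=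
  Matrix.of fun p q => Φ (Matrix.of fun i j => σ (i, p.2) (j, q.2)) p.1 q.1

/-- `id ⊗ Φ`: the map `Φ` applied to the second tensor factor. -/
def onSecond {d : ℕ} (Φ : Matrix (Fin d) (Fin d) ℂ → Matrix (Fin d) (Fin d) ℂ)
    (σ : Matrix (Fin d × Fin d) (Fin d × Fin d) ℂ) :
    Matrix (Fin d × Fin d) (Fin d × Fin d) ℂ :=
  Matrix.of fun p q => Φ (Matrix.of fun i j => σ (p.1, i) (q.1, j)) p.2 q.2

/-- The seed state after both parties' systems went through the depolarizing channel. -/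
def noisyState (lam : ℝ) {d : ℕ} (σ : Matrix (Fin d × Fin d) (Fin d × Fin d) ℂ) :
    Matrix (Fin d × Fin d) (Fin d × Fin d) ℂ :=
  onFirst (depolarize lam) (onSecond (depolarize lam) σ)

/-- The seed state `σ` generates `P` under depolarizing noise of strength `lam` on each side, by
local measurements without communication. -/
def QuantumGenerates (lam : ℝ) {d n : ℕ} (σ : Matrix (Fin d × Fin d) (Fin d × Fin d) ℂ)
    (P : Matrix (Fin n) (Fin n) ℝ) : Prop :=
  ∃ E F : Fin n → Matrix (Fin d) (Fin d) ℂ, IsPOVM E ∧ IsPOVM F ∧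
    ∀ x y, (P x y : ℂ) = ((E x ⊗ₖ F y) * noisyState lam σ).trace

/-- `P` can be generated from some seed state under noise of strength `lam`. -/
def Reachable (lam : ℝ) {n : ℕ} (P : Matrix (Fin n) (Fin n) ℝ) : Prop :=
  ∃ (d : ℕ) (σ : Matrix (Fin d × Fin d) (Fin d × Fin d) ℂ),
    IsBipartiteState σ ∧ QuantumGenerates lam σ P

/-- The least size of a seed state that generates `P` under noise of strength `lam`
(`∞` if there is none). -/
def quantumCost (lam : ℝ) {n : ℕ} (P : Matrix (Fin n) (Fin n) ℝ) : ℝ≥0∞ :=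
  ⨅ (d : ℕ) (σ : Matrix (Fin d × Fin d) (Fin d × Fin d) ℂ) (_ : IsBipartiteState σ)
    (_ : QuantumGenerates lam σ P), seedSize d

/-- The quantum advantage `S_lam(P)`; in `ℝ≥0∞` a finite number divided by `∞` is `0`. -/
def quantumAdvantage (lam : ℝ) {n : ℕ} (P : Matrix (Fin n) (Fin n) ℝ) : ℝ≥0∞ :=
  classicalComplexity P / quantumCost lam P

/-- `C`, `D` is an `r × r` PSD factorization of `P` adapted to depolarizing noise of strength
`lam`. -/
structure IsNoisyPSDFactorization (lam : ℝ) {n r : ℕ} (P : Matrix (Fin n) (Fin n) ℝ)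
    (C D : Fin n → Matrix (Fin r) (Fin r) ℂ) : Prop where
  left_psd : ∀ x, (C x).PosSemidef
  right_psd : ∀ y, (D y).PosSemidef
  factorization : ∀ x y, (P x y : ℂ) = (C x * D y).trace
  left_isUnit : IsUnit (∑ a, C a)
  right_isUnit : IsUnit (∑ b, D b)
  left_noise : ∀ x,
    (C x - ((lam : ℂ) / (r : ℂ) * (C x * (∑ a, C a)⁻¹).trace) • ∑ a, C a).PosSemidef
  right_noise : ∀ y,
    (D y - ((lam : ℂ) / (r : ℂ) * (D y * (∑ b, D b)⁻¹).trace) • ∑ b, D b).PosSemidef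

/-- The scaled slack matrix `B_m` of two concentric regular `m`-gons, the outer one with inscribed
circle of radius `1` and the inner one with circumscribed circle of radius `k`. Indices start
at `0`. -/
def polygonCorrelation (k : ℝ) (m : ℕ) : Matrix (Fin m) (Fin m) ℝ :=
  Matrix.of fun x y =>
    1 / (m : ℝ) ^ 2 * (1 - k * Real.cos (2 * Real.pi * (((x : ℕ) : ℝ) + ((y : ℕ) : ℝ)) / (m : ℝ)))

end CorrelationGeneration

end

open CorrelationGeneration

/-!
Noise of strength `λ` on both sides of a seed multiplies the covariance `P(x, y) - P_A(x) P_B(y)` of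
the generated correlation by `(1 - λ)²`. The covariance of `B_m` is `-k / m²` at the `m` entries
`(x, -x)`, so that `∑ √(-cov) = √k` there, while for every correlation this sum is at most `1`.
Hence `√k ≤ 1 - λ` whenever `B_m` is reachable; conversely, in this range noisy measurements of the
maximally entangled state of two qubits generate it, at the least possible cost `1`.

A classical seed of local dimension `d` factors the slack matrix through nonnegative vectors of
length `d`. Call `t ≥ 0` in `ℝ^d` a lift of a point `p` if `t` and the right factor yield the slacks
of `p`; the inner vertices have lifts, and every point with a lift lies in the outer polygon. If a
lift minimizes the slack at some edge, so does every lift whose support is not larger. Two edges for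
which the minimizing lifts have the same support therefore share a point of slack at most `1 - k`,
which is impossible for edges that are not neighbours because `k` is large. So the `m / 2` edges
with even index have distinct supports, and `m / 2 ≤ 2 ^ d`.
-/

namespace CorrelationGeneration

section Covariance

variable {n : ℕ}

/-- The covariance `P(x, y) - P_A(x) P_B(y)` of the events `x` and `y` under the joint distribution
`P` with marginals `P_A` and `P_B`. It measures how far `P` is from a product distribution. -/
def covariance (P : Matrix (Fin n) (Fin n) ℝ) : Matrix (Fin n) (Fin n) ℝ :=
  Matrix.of fun x y => P x y - (∑ b, P x b) * ∑ a, P a y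

theorem covariance_apply (P : Matrix (Fin n) (Fin n) ℝ) (x y : Fin n) :
    covariance P x y = P x y - (∑ b, P x b) * ∑ a, P a y := rfl

theorem covariance_eq_zero_of_product {P : Matrix (Fin n) (Fin n) ℝ} {f g : Fin n → ℝ}
    (hf : ∑ x, f x = 1) (hg : ∑ y, g y = 1) (h : ∀ x y, P x y = f x * g y) :
    covariance P = 0 := by
  ext x y
  simp only [covariance_apply, h, ← Finset.mul_sum, ← Finset.sum_mul, hf, hg, mul_one, one_mul,
    sub_self, Matrix.zero_apply]

/-- Since `-covariance P x y` is at most the product of the marginals, this is the Cauchy–Schwarz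
inequality for the square roots of the marginals. -/
theorem IsCorrelation.sum_sqrt_neg_covariance_le_one {P : Matrix (Fin n) (Fin n) ℝ}
    (hP : IsCorrelation P) (e : Equiv.Perm (Fin n)) : ∑ x, √(-covariance P x (e x)) ≤ 1 := by
  set α : Fin n → ℝ := fun x => ∑ b, P x b
  set β : Fin n → ℝ := fun y => ∑ a, P a y
  have hα : ∀ x, 0 ≤ α x := fun x => Finset.sum_nonneg fun b _ => hP.nonneg x b
  have hβ : ∀ y, 0 ≤ β y := fun y => Finset.sum_nonneg fun a _ => hP.nonneg a y
  have hα_sum : ∑ x, α x = 1 := hP.sum_eq_one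
  have hβ_sum : ∑ x, β (e x) = 1 := by
    rw [Equiv.sum_comp e β, Finset.sum_comm]
    exact hP.sum_eq_one
  calc ∑ x, √(-covariance P x (e x))
      ≤ ∑ x, √(α x) * √(β (e x)) := by
        refine Finset.sum_le_sum fun x _ => ?_
        rw [← Real.sqrt_mul (hα x), covariance_apply]
        exact Real.sqrt_le_sqrt (by linarith [hP.nonneg x (e x)])
    _ ≤ √(∑ x, α x) * √(∑ x, β (e x)) :=
        Real.sum_sqrt_mul_sqrt_le _ hα fun x => hβ (e x)
    _ = 1 := by rw [hα_sum, hβ_sum, Real.sqrt_one, one_mul]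

end Covariance

section PolygonAngles

variable {m : ℕ}

/-- The direction `2πx / m` of the vertex with index `x` of the regular `m`-gon. -/
noncomputable def vertexAngle (x : Fin m) : ℝ := 2 * Real.pi * ((x : ℕ) : ℝ) / m

theorem polygonCorrelation_apply (k : ℝ) (x y : Fin m) :
    polygonCorrelation k m x y =
      1 / (m : ℝ) ^ 2 * (1 - k * Real.cos (vertexAngle x + vertexAngle y)) := by
  simp only [polygonCorrelation, vertexAngle, Matrix.of_apply, mul_add, add_div]

theorem sum_exp_vertexAngle (hm : 2 ≤ m) :
    ∑ x : Fin m, Complex.exp (vertexAngle x * Complex.I) = 0 := by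
  have h := (Complex.isPrimitiveRoot_exp m (by omega)).geom_sum_eq_zero (by omega)
  rw [← Fin.sum_univ_eq_sum_range (fun i => Complex.exp (2 * Real.pi * Complex.I / m) ^ i)] at h
  rw [← h]
  refine Finset.sum_congr rfl fun x _ => ?_
  rw [← Complex.exp_nat_mul, vertexAngle]
  push_cast
  ring_nf

theorem sum_cos_vertexAngle (hm : 2 ≤ m) : ∑ x : Fin m, Real.cos (vertexAngle x) = 0 := by
  simpa only [Complex.re_sum, Complex.exp_ofReal_mul_I_re, Complex.zero_re] using
    congrArg Complex.re (sum_exp_vertexAngle hm)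

theorem sum_sin_vertexAngle (hm : 2 ≤ m) : ∑ x : Fin m, Real.sin (vertexAngle x) = 0 := by
  simpa only [Complex.im_sum, Complex.exp_ofReal_mul_I_im, Complex.zero_im] using
    congrArg Complex.im (sum_exp_vertexAngle hm)

theorem sum_cos_add_vertexAngle (hm : 2 ≤ m) (φ : ℝ) :
    ∑ x : Fin m, Real.cos (φ + vertexAngle x) = 0 := by
  simp only [Real.cos_add, Finset.sum_sub_distrib, ← Finset.mul_sum, sum_cos_vertexAngle hm,
    sum_sin_vertexAngle hm, mul_zero, sub_zero]

theorem cos_vertexAngle_add_vertexAngle_neg [NeZero m] (x : Fin m) :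
    Real.cos (vertexAngle x + vertexAngle (-x)) = 1 := by
  obtain ⟨l, hl⟩ : m ∣ (x : ℕ) + ((-x : Fin m) : ℕ) := by
    apply Nat.dvd_of_mod_eq_zero
    rw [← Fin.val_add, add_neg_cancel, Fin.val_zero]
  have hlR : ((x : ℕ) : ℝ) + ((-x : Fin m) : ℕ) = m * l := by exact_mod_cast hl
  have hm : (m : ℝ) ≠ 0 := NeZero.ne _
  have : vertexAngle x + vertexAngle (-x) = l * (2 * Real.pi) := by
    rw [vertexAngle, vertexAngle, ← add_div, ← mul_add, hlR]
    field_simp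
  rw [this, Real.cos_nat_mul_two_pi]

end PolygonAngles

section PolygonCovariance

variable {m : ℕ}

theorem sum_polygonCorrelation_right (hm : 2 ≤ m) (k : ℝ) (x : Fin m) :
    ∑ y, polygonCorrelation k m x y = 1 / m := by
  have hm0 : (m : ℝ) ≠ 0 := by positivity
  simp only [polygonCorrelation_apply, ← Finset.mul_sum, Finset.sum_sub_distrib,
    sum_cos_add_vertexAngle hm, Finset.sum_const, Finset.card_univ, Fintype.card_fin, nsmul_eq_mul]
  field_simp
  ring

theorem sum_polygonCorrelation_left (hm : 2 ≤ m) (k : ℝ) (y : Fin m) :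
    ∑ x, polygonCorrelation k m x y = 1 / m := by
  rw [← sum_polygonCorrelation_right hm k y]
  simp only [polygonCorrelation_apply, add_comm]

theorem isCorrelation_polygonCorrelation {k : ℝ} (hk0 : 0 ≤ k) (hk1 : k ≤ 1) (hm : 2 ≤ m) :
    IsCorrelation (polygonCorrelation k m) where
  nonneg x y := by
    rw [polygonCorrelation_apply]
    refine mul_nonneg (by positivity) (sub_nonneg.mpr ?_)
    exact (mul_le_of_le_one_right hk0 (Real.cos_le_one _)).trans hk1
  sum_eq_one := by
    have hm0 : (m : ℝ) ≠ 0 := by positivity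
    simp [sum_polygonCorrelation_right hm, hm0]

theorem covariance_polygonCorrelation_neg [NeZero m] (hm : 2 ≤ m) (k : ℝ) (x : Fin m) :
    covariance (polygonCorrelation k m) x (-x) = -(k / (m : ℝ) ^ 2) := by
  rw [covariance_apply, sum_polygonCorrelation_right hm, sum_polygonCorrelation_left hm,
    polygonCorrelation_apply, cos_vertexAngle_add_vertexAngle_neg]
  ring

theorem covariance_polygonCorrelation_ne_zero {k : ℝ} (hk : k ≠ 0) (hm : 2 ≤ m) :
    covariance (polygonCorrelation k m) ≠ 0 := by
  have : NeZero m := ⟨by omega⟩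
  intro h
  have h0 := covariance_polygonCorrelation_neg hm k (0 : Fin m)
  rw [h, Matrix.zero_apply, zero_eq_neg] at h0
  exact div_ne_zero hk (pow_ne_zero 2 (NeZero.ne _)) h0

end PolygonCovariance

section LocalNoise

variable {d : ℕ}

theorem trace_kronecker_mul_eq_sum (A B : Matrix (Fin d) (Fin d) ℂ)
    (τ : Matrix (Fin d × Fin d) (Fin d × Fin d) ℂ) :
    ((A ⊗ₖ B) * τ).trace =
      ∑ j, ∑ l, B j l * (A * Matrix.of fun a b => τ (a, l) (b, j)).trace := by
  simp only [Matrix.trace, Matrix.diag, Matrix.mul_apply, Matrix.kroneckerMap_apply,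
    Fintype.sum_prod_type_right, Matrix.of_apply, Finset.mul_sum]
  refine Finset.sum_congr rfl fun j _ => ?_
  conv_rhs => rw [Finset.sum_comm]
  refine Finset.sum_congr rfl fun i _ => Finset.sum_congr rfl fun l _ => ?_
  exact Finset.sum_congr rfl fun a _ => by ring

theorem trace_kronecker_mul_swap (A B : Matrix (Fin d) (Fin d) ℂ)
    (τ : Matrix (Fin d × Fin d) (Fin d × Fin d) ℂ) :
    ((A ⊗ₖ B) * τ).trace = ((B ⊗ₖ A) * τ.submatrix Prod.swap Prod.swap).trace := by
  have h : B ⊗ₖ A = (A ⊗ₖ B).submatrix Prod.swap Prod.swap :=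
    Matrix.ext fun _ _ => mul_comm _ _
  rw [h, ← Matrix.submatrix_mul _ _ _ _ _ Prod.swap_bijective]
  exact (Equiv.sum_comp (Equiv.prodComm (Fin d) (Fin d)) fun p => ((A ⊗ₖ B) * τ) p p).symm

theorem trace_kronecker_mul_onFirst {Φ Ψ : Matrix (Fin d) (Fin d) ℂ → Matrix (Fin d) (Fin d) ℂ}
    (h : ∀ A ρ, (A * Φ ρ).trace = (Ψ A * ρ).trace) (A B : Matrix (Fin d) (Fin d) ℂ)
    (σ : Matrix (Fin d × Fin d) (Fin d × Fin d) ℂ) :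
    ((A ⊗ₖ B) * onFirst Φ σ).trace = ((Ψ A ⊗ₖ B) * σ).trace := by
  rw [trace_kronecker_mul_eq_sum, trace_kronecker_mul_eq_sum]
  refine Finset.sum_congr rfl fun j _ => Finset.sum_congr rfl fun l _ => ?_
  rw [← h]
  rfl

theorem trace_kronecker_mul_onSecond {Φ Ψ : Matrix (Fin d) (Fin d) ℂ → Matrix (Fin d) (Fin d) ℂ}
    (h : ∀ A ρ, (A * Φ ρ).trace = (Ψ A * ρ).trace) (A B : Matrix (Fin d) (Fin d) ℂ)
    (σ : Matrix (Fin d × Fin d) (Fin d × Fin d) ℂ) :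
    ((A ⊗ₖ B) * onSecond Φ σ).trace = ((A ⊗ₖ Ψ B) * σ).trace := by
  rw [trace_kronecker_mul_swap, trace_kronecker_mul_swap A, ← trace_kronecker_mul_onFirst h]
  rfl

theorem trace_mul_depolarize (lam : ℝ) (A ρ : Matrix (Fin d) (Fin d) ℂ) :
    (A * depolarize lam ρ).trace = (depolarize lam A * ρ).trace := by
  simp only [depolarize, Matrix.mul_add, Matrix.add_mul, Matrix.mul_smul, Matrix.smul_mul,
    Matrix.trace_add, Matrix.trace_smul, Matrix.mul_one, Matrix.one_mul, smul_eq_mul]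
  ring

theorem trace_kronecker_mul_noisyState (lam : ℝ) (A B : Matrix (Fin d) (Fin d) ℂ)
    (σ : Matrix (Fin d × Fin d) (Fin d × Fin d) ℂ) :
    ((A ⊗ₖ B) * noisyState lam σ).trace =
      ((depolarize lam A ⊗ₖ depolarize lam B) * σ).trace := by
  rw [noisyState, trace_kronecker_mul_onFirst (trace_mul_depolarize lam),
    trace_kronecker_mul_onSecond (trace_mul_depolarize lam)]

end LocalNoise

section OperatorCovariance

variable {d n : ℕ}

/-- The covariance `tr((A ⊗ B)σ) - tr((A ⊗ 1)σ) tr((1 ⊗ B)σ)` of the local operators `A` and `B` in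
the bipartite state `σ`. -/
def operatorCovariance (σ : Matrix (Fin d × Fin d) (Fin d × Fin d) ℂ)
    (A B : Matrix (Fin d) (Fin d) ℂ) : ℂ :=
  ((A ⊗ₖ B) * σ).trace -
    ((A ⊗ₖ (1 : Matrix (Fin d) (Fin d) ℂ)) * σ).trace *
      (((1 : Matrix (Fin d) (Fin d) ℂ) ⊗ₖ B) * σ).trace

variable {σ : Matrix (Fin d × Fin d) (Fin d × Fin d) ℂ}

theorem operatorCovariance_smul_add_smul_one_left (hσ : σ.trace = 1) (a c : ℂ)
    (A B : Matrix (Fin d) (Fin d) ℂ) :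
    operatorCovariance σ (a • A + c • 1) B = a * operatorCovariance σ A B := by
  simp only [operatorCovariance, Matrix.add_kronecker, Matrix.smul_kronecker, Matrix.add_mul,
    Matrix.smul_mul, Matrix.trace_add, Matrix.trace_smul, Matrix.one_kronecker_one, Matrix.one_mul,
    smul_eq_mul, hσ]
  ring

theorem operatorCovariance_smul_add_smul_one_right (hσ : σ.trace = 1) (a c : ℂ)
    (A B : Matrix (Fin d) (Fin d) ℂ) :
    operatorCovariance σ A (a • B + c • 1) = a * operatorCovariance σ A B := by
  simp only [operatorCovariance, Matrix.kronecker_add, Matrix.kronecker_smul, Matrix.add_mul,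
    Matrix.smul_mul, Matrix.trace_add, Matrix.trace_smul, Matrix.one_kronecker_one, Matrix.one_mul,
    smul_eq_mul, hσ]
  ring

theorem operatorCovariance_depolarize (hσ : σ.trace = 1) (lam : ℝ)
    (A B : Matrix (Fin d) (Fin d) ℂ) :
    operatorCovariance σ (depolarize lam A) (depolarize lam B) =
      (1 - lam) ^ 2 * operatorCovariance σ A B := by
  rw [depolarize, depolarize, operatorCovariance_smul_add_smul_one_left hσ,
    operatorCovariance_smul_add_smul_one_right hσ]
  ring

theorem operatorCovariance_eq_zero_of_dim_one
    {σ : Matrix (Fin 1 × Fin 1) (Fin 1 × Fin 1) ℂ} (hσ : σ.trace = 1)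
    (A B : Matrix (Fin 1) (Fin 1) ℂ) : operatorCovariance σ A B = 0 := by
  have hA : A = (0 : ℂ) • A + A 0 0 • 1 := by
    ext i j
    rw [Subsingleton.elim i 0, Subsingleton.elim j 0]
    simp
  rw [hA, operatorCovariance_smul_add_smul_one_left hσ, zero_mul]

theorem sum_trace_kronecker_mul_left {ι : Type*} [Fintype ι] (E : ι → Matrix (Fin d) (Fin d) ℂ)
    (B : Matrix (Fin d) (Fin d) ℂ) (σ : Matrix (Fin d × Fin d) (Fin d × Fin d) ℂ) :
    ∑ x, ((E x ⊗ₖ B) * σ).trace = (((∑ x, E x) ⊗ₖ B) * σ).trace := by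
  rw [← Matrix.trace_sum, ← Finset.sum_mul]
  congr 2
  exact (map_sum ((Matrix.kroneckerBilinear (R := ℂ) (α := ℂ)).flip B) E Finset.univ).symm

theorem sum_trace_kronecker_mul_right {ι : Type*} [Fintype ι] (A : Matrix (Fin d) (Fin d) ℂ)
    (F : ι → Matrix (Fin d) (Fin d) ℂ) (σ : Matrix (Fin d × Fin d) (Fin d × Fin d) ℂ) :
    ∑ y, ((A ⊗ₖ F y) * σ).trace = ((A ⊗ₖ (∑ y, F y)) * σ).trace := by
  rw [← Matrix.trace_sum, ← Finset.sum_mul]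
  congr 2
  exact (map_sum (Matrix.kroneckerBilinear (R := ℂ) (α := ℂ) A) F Finset.univ).symm

theorem ofReal_covariance_eq_operatorCovariance {P : Matrix (Fin n) (Fin n) ℝ}
    {E F : Fin n → Matrix (Fin d) (Fin d) ℂ} (hE : ∑ x, E x = 1) (hF : ∑ y, F y = 1)
    (hP : ∀ x y, (P x y : ℂ) = ((E x ⊗ₖ F y) * σ).trace) (x y : Fin n) :
    (covariance P x y : ℂ) = operatorCovariance σ (E x) (F y) := by
  rw [covariance_apply, operatorCovariance]
  push_cast
  simp only [hP, sum_trace_kronecker_mul_left, sum_trace_kronecker_mul_right, hE, hF]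

end OperatorCovariance

section Generation

variable {d n : ℕ} {σ : Matrix (Fin d × Fin d) (Fin d × Fin d) ℂ} {P : Matrix (Fin n) (Fin n) ℝ}

open scoped MatrixOrder Matrix.Norms.L2Operator in
theorem trace_mul_nonneg_of_posSemidef {ι : Type*} [Fintype ι] {A B : Matrix ι ι ℂ}
    (hA : A.PosSemidef) (hB : B.PosSemidef) : 0 ≤ (A * B).trace := by
  classical
  obtain ⟨S, rfl⟩ := CStarAlgebra.nonneg_iff_eq_star_mul_self.mp hB.nonneg
  rw [← Matrix.mul_assoc, Matrix.trace_mul_comm, ← Matrix.mul_assoc]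
  exact (hA.mul_mul_conjTranspose_same S).trace_nonneg

theorem IsBipartiteState.dim_ne_zero (hσ : IsBipartiteState σ) : d ≠ 0 := by
  rintro rfl
  simpa [Matrix.trace] using hσ.trace_eq_one

theorem IsPOVM.depolarize_sum_eq_one {E : Fin n → Matrix (Fin d) (Fin d) ℂ} (hE : IsPOVM E)
    (hd : d ≠ 0) (lam : ℝ) : ∑ x, depolarize lam (E x) = 1 := by
  have hd' : (d : ℂ) ≠ 0 := Nat.cast_ne_zero.mpr hd
  simp only [depolarize, Finset.sum_add_distrib, ← Finset.smul_sum, ← Finset.sum_smul,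
    ← Finset.sum_div, ← Finset.mul_sum, ← Matrix.trace_sum, hE.sum_eq_one, Matrix.trace_one,
    Fintype.card_fin, mul_div_cancel_right₀ _ hd', ← add_smul, sub_add_cancel, one_smul]

theorem IsBipartiteState.ofReal_covariance_eq (hσ : IsBipartiteState σ) {lam : ℝ}
    {E F : Fin n → Matrix (Fin d) (Fin d) ℂ} (hE : IsPOVM E) (hF : IsPOVM F)
    (hP : ∀ x y, (P x y : ℂ) = ((E x ⊗ₖ F y) * noisyState lam σ).trace) (x y : Fin n) :
    (covariance P x y : ℂ) = (1 - lam) ^ 2 * operatorCovariance σ (E x) (F y) := by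
  rw [← operatorCovariance_depolarize hσ.trace_eq_one]
  exact ofReal_covariance_eq_operatorCovariance (E := fun x => depolarize lam (E x))
    (F := fun y => depolarize lam (F y)) (hE.depolarize_sum_eq_one hσ.dim_ne_zero lam)
    (hF.depolarize_sum_eq_one hσ.dim_ne_zero lam)
    (fun x y => by rw [hP, trace_kronecker_mul_noisyState]) x y

theorem IsBipartiteState.exists_isCorrelation (hσ : IsBipartiteState σ)
    {E F : Fin n → Matrix (Fin d) (Fin d) ℂ} (hE : IsPOVM E) (hF : IsPOVM F) :
    ∃ Q : Matrix (Fin n) (Fin n) ℝ, IsCorrelation Q ∧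
      ∀ x y, (Q x y : ℂ) = ((E x ⊗ₖ F y) * σ).trace := by
  have hQ : ∀ x y, 0 ≤ ((E x ⊗ₖ F y) * σ).trace := fun x y =>
    trace_mul_nonneg_of_posSemidef ((hE.posSemidef x).kronecker (hF.posSemidef y)) hσ.posSemidef
  have hre : ∀ x y, (((E x ⊗ₖ F y) * σ).trace.re : ℂ) = ((E x ⊗ₖ F y) * σ).trace :=
    fun x y => (Complex.eq_re_of_ofReal_le (hQ x y)).symm
  refine ⟨Matrix.of fun x y => ((E x ⊗ₖ F y) * σ).trace.re,
    ⟨fun x y => (Complex.nonneg_iff.mp (hQ x y)).1, Complex.ofReal_injective ?_⟩, hre⟩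
  push_cast
  simp only [Matrix.of_apply, hre, sum_trace_kronecker_mul_right, hF.sum_eq_one,
    sum_trace_kronecker_mul_left, hE.sum_eq_one, Matrix.one_kronecker_one, Matrix.one_mul,
    hσ.trace_eq_one]

/-- `Q` is what the same measurements yield on `σ` without noise. -/
theorem QuantumGenerates.exists_covariance_eq {lam : ℝ} (h : QuantumGenerates lam σ P)
    (hσ : IsBipartiteState σ) :
    ∃ Q, IsCorrelation Q ∧ covariance P = (1 - lam) ^ 2 • covariance Q := by
  obtain ⟨E, F, hE, hF, hP⟩ := h
  obtain ⟨Q, hQ, hQ_eq⟩ := hσ.exists_isCorrelation hE hF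
  refine ⟨Q, hQ, Matrix.ext fun x y => Complex.ofReal_injective ?_⟩
  rw [hσ.ofReal_covariance_eq hE hF hP, Matrix.smul_apply, smul_eq_mul, Complex.ofReal_mul,
    ofReal_covariance_eq_operatorCovariance hE.sum_eq_one hF.sum_eq_one hQ_eq]
  push_cast
  rfl

theorem QuantumGenerates.two_le_dim {lam : ℝ} (h : QuantumGenerates lam σ P)
    (hσ : IsBipartiteState σ) (hP : covariance P ≠ 0) : 2 ≤ d := by
  obtain ⟨E, F, hE, hF, hEF⟩ := h
  by_contra hd
  obtain rfl : d = 1 := by have := hσ.dim_ne_zero; omega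
  refine hP (Matrix.ext fun x y => Complex.ofReal_injective ?_)
  rw [hσ.ofReal_covariance_eq hE hF hEF, operatorCovariance_eq_zero_of_dim_one hσ.trace_eq_one,
    mul_zero, Matrix.zero_apply, Complex.ofReal_zero]

theorem ClassicallyGenerates.two_le_dim {P' : Matrix (Fin d) (Fin d) ℝ}
    (h : ClassicallyGenerates P' P) (hP' : IsCorrelation P') (hP : covariance P ≠ 0) : 2 ≤ d := by
  obtain ⟨K, L, hK, hL, hKL⟩ := h
  by_contra hd
  obtain rfl | rfl : d = 0 ∨ d = 1 := by omega
  · simpa using hP'.sum_eq_one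
  · have hP'_one : P' 0 0 = 1 := by simpa using hP'.sum_eq_one
    refine hP (covariance_eq_zero_of_product (hK.sum_eq_one 0) (hL.sum_eq_one 0) fun x y => ?_)
    simp [hKL, hP'_one]

theorem one_le_seedSize (hd : 2 ≤ d) : 1 ≤ seedSize d := by
  rw [seedSize]
  exact_mod_cast Nat.clog_pos one_lt_two hd

theorem one_le_quantumCost (hP : covariance P ≠ 0) (lam : ℝ) : 1 ≤ quantumCost lam P :=
  le_iInf fun _ => le_iInf fun _ => le_iInf fun hσ => le_iInf fun h =>
    one_le_seedSize (h.two_le_dim hσ hP)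

theorem quantumCost_eq_top {lam : ℝ} (h : ¬ Reachable lam P) : quantumCost lam P = ⊤ := by
  simp only [quantumCost, iInf_eq_top]
  exact fun d σ hσ hgen => absurd ⟨d, σ, hσ, hgen⟩ h

theorem quantumAdvantage_eq_zero {lam : ℝ} (h : ¬ Reachable lam P) :
    quantumAdvantage lam P = 0 := by
  rw [quantumAdvantage, quantumCost_eq_top h, ENNReal.div_top]

end Generation

section NoiseThreshold

theorem sqrt_le_of_reachable_polygonCorrelation {k : ℝ} {m : ℕ} (hm : 2 ≤ m) {lam : ℝ}
    (hlam : lam ≤ 1) (h : Reachable lam (polygonCorrelation k m)) : √k ≤ 1 - lam := by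
  obtain ⟨d, σ, hσ, hgen⟩ := h
  obtain ⟨Q, hQ, hcov⟩ := hgen.exists_covariance_eq hσ
  have : NeZero m := ⟨by omega⟩
  have hentry (x : Fin m) : √k / m = (1 - lam) * √(-covariance Q x (-x)) := by
    have hx : (1 - lam) ^ 2 * -covariance Q x (-x) = k / (m : ℝ) ^ 2 := by
      rw [mul_neg, ← smul_eq_mul, ← Matrix.smul_apply, ← hcov,
        covariance_polygonCorrelation_neg hm, neg_neg]
    rw [← Real.sqrt_sq (sub_nonneg.mpr hlam), ← Real.sqrt_mul (sq_nonneg _), hx,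
      Real.sqrt_div' _ (sq_nonneg _), Real.sqrt_sq (Nat.cast_nonneg m)]
  calc √k = ∑ _x : Fin m, √k / m := by
        rw [Finset.sum_const, Finset.card_univ, Fintype.card_fin, nsmul_eq_mul,
          mul_div_cancel₀ _ (NeZero.ne (m : ℝ))]
    _ = (1 - lam) * ∑ x, √(-covariance Q x (-x)) := by
        rw [Finset.mul_sum]
        exact Finset.sum_congr rfl fun x _ => hentry x
    _ ≤ 1 - lam :=
        mul_le_of_le_one_right (sub_nonneg.mpr hlam)
          (hQ.sum_sqrt_neg_covariance_le_one (Equiv.neg (Fin m)))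

end NoiseThreshold

section PolygonDirections

variable {m : ℕ}

theorem exists_vertexAngle_eq [NeZero m] (N : ℤ) :
    ∃ (x : Fin m) (l : ℤ), vertexAngle x = 2 * Real.pi / m * N + l * (2 * Real.pi) := by
  have hm : (0 : ℤ) < m := by exact_mod_cast NeZero.pos m
  have hnonneg := Int.emod_nonneg N hm.ne'
  have hlt := Int.emod_lt_of_pos N hm
  refine ⟨⟨(N % m).toNat, by omega⟩, -(N / m), ?_⟩
  have hx : (((N % m).toNat : ℕ) : ℝ) = N - m * ((N / m : ℤ) : ℝ) := by
    have : (((N % m).toNat : ℕ) : ℤ) = N - m * (N / m) := by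
      rw [Int.toNat_of_nonneg hnonneg, Int.emod_def]
    exact_mod_cast this
  have hm0 : (m : ℝ) ≠ 0 := NeZero.ne _
  rw [vertexAngle, hx]
  push_cast
  field_simp
  ring

theorem exists_cos_pi_div_le_cos_add_vertexAngle [NeZero m] (φ : ℝ) :
    ∃ x : Fin m, Real.cos (Real.pi / m) ≤ Real.cos (φ + vertexAngle x) := by
  have hm : (0 : ℝ) < m := by exact_mod_cast NeZero.pos m
  set s : ℝ := -φ * m / (2 * Real.pi) with hs
  obtain ⟨x, l, hx⟩ := exists_vertexAngle_eq (m := m) (round s)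
  refine ⟨x, ?_⟩
  have hangle : φ + vertexAngle x = -(2 * Real.pi / m * (s - round s)) + l * (2 * Real.pi) := by
    rw [hx, hs]
    field_simp
    ring
  have hbound : |2 * Real.pi / m * (s - round s)| ≤ Real.pi / m := by
    rw [abs_mul, abs_of_pos (by positivity)]
    calc 2 * Real.pi / m * |s - round s| ≤ 2 * Real.pi / m * (1 / 2) := by
          gcongr
          exact abs_sub_round s
      _ = Real.pi / m := by ring
  rw [hangle, Real.cos_add_int_mul_two_pi, Real.cos_neg,
    ← Real.cos_abs (2 * Real.pi / m * _)]
  exact Real.cos_le_cos_of_nonneg_of_le_pi (abs_nonneg _)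
    (div_le_self Real.pi_pos.le (by exact_mod_cast NeZero.one_le)) hbound

theorem cos_le_cos_of_le_of_le_two_pi_sub {a x : ℝ} (ha : 0 ≤ a) (hax : a ≤ x)
    (hx : x ≤ 2 * Real.pi - a) : Real.cos x ≤ Real.cos a := by
  rcases le_total x Real.pi with hxπ | hxπ
  · exact Real.cos_le_cos_of_nonneg_of_le_pi ha hxπ hax
  · rw [← Real.cos_two_pi_sub x]
    exact Real.cos_le_cos_of_nonneg_of_le_pi ha (by linarith) (by linarith)

theorem cos_vertexAngle_sub_le {x y : Fin m} {s : ℕ} (hxy : (x : ℕ) + s ≤ y)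
    (hyx : (y : ℕ) + s ≤ x + m) :
    Real.cos (vertexAngle x - vertexAngle y) ≤ Real.cos (2 * Real.pi * s / m) := by
  have hm : (0 : ℝ) < m := by exact_mod_cast x.pos
  have hxy' : ((x : ℕ) : ℝ) + s ≤ (y : ℕ) := by exact_mod_cast hxy
  have hyx' : ((y : ℕ) : ℝ) + s ≤ (x : ℕ) + m := by exact_mod_cast hyx
  have hsub : vertexAngle y - vertexAngle x = 2 * Real.pi * ((y : ℕ) - (x : ℕ)) / m := by
    rw [vertexAngle, vertexAngle]
    ring
  rw [← Real.cos_neg, neg_sub, hsub]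
  apply cos_le_cos_of_le_of_le_two_pi_sub (by positivity)
  · gcongr
    linarith
  · rw [le_sub_iff_add_le, ← add_div, ← mul_add, div_le_iff₀ hm]
    gcongr
    linarith

theorem two_mul_sq_sub_one_lt_cos_sub {c A B : ℝ} (hc : 0 ≤ c) (hA : c < Real.cos A)
    (hB : c < Real.cos B) : 2 * c ^ 2 - 1 < Real.cos (A - B) := by
  have hcos : c ^ 2 < Real.cos A * Real.cos B := by nlinarith
  have hsinA : Real.sin A ^ 2 ≤ 1 - c ^ 2 := by nlinarith [Real.sin_sq_add_cos_sq A]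
  have hsinB : Real.sin B ^ 2 ≤ 1 - c ^ 2 := by nlinarith [Real.sin_sq_add_cos_sq B]
  rw [Real.cos_sub]
  nlinarith [sq_nonneg (Real.sin A + Real.sin B)]

end PolygonDirections

section Slack

variable {m : ℕ}

/-- The slack of the point `p` of the plane with respect to the edge with index `y` of the regular
`m`-gon circumscribed about the unit circle: the distance of `p` from the line through that edge,
counted negatively beyond it. The outer normal of the edge is the conjugate of
`exp (vertexAngle y * I)`, which makes the slacks of the inner polygon depend on the sum of the
indices, as in `polygonCorrelation`. -/
noncomputable def slack (p : ℂ) (y : Fin m) : ℝ :=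
  1 - (p * Complex.exp (vertexAngle y * Complex.I)).re

theorem slack_eq_one_sub_norm_mul_cos (p : ℂ) (y : Fin m) :
    slack p y = 1 - ‖p‖ * Real.cos (p.arg + vertexAngle y) := by
  conv_lhs => rw [slack, ← Complex.norm_mul_exp_arg_mul_I p]
  rw [mul_assoc, ← Complex.exp_add, ← add_mul, ← Complex.ofReal_add, Complex.re_ofReal_mul,
    Complex.exp_ofReal_mul_I_re]

theorem slack_mul_exp_vertexAngle (k : ℝ) (x y : Fin m) :
    slack (k * Complex.exp (vertexAngle x * Complex.I)) y =
      1 - k * Real.cos (vertexAngle x + vertexAngle y) := by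
  rw [slack, mul_assoc, ← Complex.exp_add, ← add_mul, ← Complex.ofReal_add, Complex.re_ofReal_mul,
    Complex.exp_ofReal_mul_I_re]

theorem slack_mul_exp_vertexAngle_neg [NeZero m] (k : ℝ) (y : Fin m) :
    slack (k * Complex.exp (vertexAngle (-y) * Complex.I)) y = 1 - k := by
  rw [slack_mul_exp_vertexAngle, add_comm, cos_vertexAngle_add_vertexAngle_neg, mul_one]

theorem slack_add_smul_sub (p q : ℂ) (ε : ℝ) (y : Fin m) :
    slack (p + ε • (p - q)) y = slack p y + ε * (slack p y - slack q y) := by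
  simp only [slack, add_mul, sub_mul, smul_mul_assoc, Complex.add_re, Complex.smul_re,
    Complex.sub_re, smul_eq_mul]
  ring

theorem sum_slack (hm : 2 ≤ m) (p : ℂ) : ∑ y : Fin m, slack p y = m := by
  simp only [slack, Finset.sum_sub_distrib, ← Complex.re_sum, ← Finset.mul_sum,
    sum_exp_vertexAngle hm, mul_zero, Complex.zero_re, sub_zero, Finset.sum_const,
    Finset.card_univ, Fintype.card_fin, nsmul_one]

theorem continuous_slack (y : Fin m) : Continuous fun p => slack p y := by
  unfold slack
  fun_prop

theorem norm_mul_cos_pi_div_le_one [NeZero m] {p : ℂ} (hp : ∀ y : Fin m, 0 ≤ slack p y) :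
    ‖p‖ * Real.cos (Real.pi / m) ≤ 1 := by
  obtain ⟨y, hy⟩ := exists_cos_pi_div_le_cos_add_vertexAngle (m := m) p.arg
  have hpy := hp y
  rw [slack_eq_one_sub_norm_mul_cos] at hpy
  linarith [mul_le_mul_of_nonneg_left hy (norm_nonneg p)]

theorem cos_pi_div_nat_pos (hm : 3 ≤ m) : 0 < Real.cos (Real.pi / m) := by
  have : Real.pi / m ≤ Real.pi / 3 := by gcongr; exact_mod_cast hm
  exact Real.cos_pos_of_mem_Ioo ⟨by linarith [Real.pi_pos, show 0 ≤ Real.pi / m by positivity],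
    by linarith [Real.pi_pos]⟩

theorem mul_cos_pi_div_le_cos_of_slack_le {p : ℂ} (hm : 3 ≤ m) (hp : ∀ y : Fin m, 0 ≤ slack p y)
    {k : ℝ} (hk : 0 < k) {y : Fin m} (hy : slack p y ≤ 1 - k) :
    k * Real.cos (Real.pi / m) ≤ Real.cos (p.arg + vertexAngle y) := by
  have : NeZero m := ⟨by omega⟩
  have hky : k ≤ ‖p‖ * Real.cos (p.arg + vertexAngle y) := by
    rw [slack_eq_one_sub_norm_mul_cos] at hy
    linarith
  have hcos : 0 ≤ Real.cos (p.arg + vertexAngle y) :=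
    (pos_of_mul_pos_right (hk.trans_le hky) (norm_nonneg p)).le
  calc k * Real.cos (Real.pi / m)
      ≤ ‖p‖ * Real.cos (p.arg + vertexAngle y) * Real.cos (Real.pi / m) := by
        gcongr
        exact (cos_pi_div_nat_pos hm).le
    _ = ‖p‖ * Real.cos (Real.pi / m) * Real.cos (p.arg + vertexAngle y) := by ring
    _ ≤ Real.cos (p.arg + vertexAngle y) :=
        mul_le_of_le_one_left hcos (norm_mul_cos_pi_div_le_one hp)

theorem cos_two_pi_div_nat_nonneg (hm : 4 ≤ m) : 0 ≤ Real.cos (2 * Real.pi / m) := by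
  have hm' : (4 : ℝ) ≤ m := by exact_mod_cast hm
  have : 2 * Real.pi / m ≤ Real.pi / 2 := by
    rw [div_le_div_iff₀ (by positivity) two_pos]
    nlinarith [Real.pi_pos]
  exact Real.cos_nonneg_of_mem_Icc
    ⟨by linarith [Real.pi_pos, show 0 ≤ 2 * Real.pi / m by positivity], this⟩

theorem cos_two_pi_div_lt_mul_cos_pi_div (hm : 4 ≤ m) {k : ℝ}
    (hk : Real.cos (2 * Real.pi / m) / Real.cos (Real.pi / m) ^ 2 < k) :
    Real.cos (2 * Real.pi / m) < k * Real.cos (Real.pi / m) := by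
  have hpos := cos_pi_div_nat_pos (m := m) (by omega)
  calc Real.cos (2 * Real.pi / m) ≤ Real.cos (2 * Real.pi / m) / Real.cos (Real.pi / m) :=
        le_div_self (cos_two_pi_div_nat_nonneg hm) hpos (Real.cos_le_one _)
    _ < k * Real.cos (Real.pi / m) := by
        rwa [div_lt_iff₀ hpos, mul_assoc, ← sq, ← div_lt_iff₀ (by positivity)]

/-- The condition on `k` forces the direction of `p` to be within `2π / m` of both outer normals. -/
theorem cos_four_pi_div_lt_cos_vertexAngle_sub (hm : 4 ≤ m) {k : ℝ} (hk0 : 0 < k)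
    (hk : Real.cos (2 * Real.pi / m) / Real.cos (Real.pi / m) ^ 2 < k) {p : ℂ}
    (hp : ∀ y : Fin m, 0 ≤ slack p y) {x y : Fin m} (hx : slack p x ≤ 1 - k)
    (hy : slack p y ≤ 1 - k) :
    Real.cos (4 * Real.pi / m) < Real.cos (vertexAngle x - vertexAngle y) := by
  have hck := cos_two_pi_div_lt_mul_cos_pi_div hm hk
  have hfour : 4 * Real.pi / m = 2 * (2 * Real.pi / m) := by ring
  rw [hfour, Real.cos_two_mul, ← add_sub_add_left_eq_sub (vertexAngle x) _ p.arg]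
  exact two_mul_sq_sub_one_lt_cos_sub (cos_two_pi_div_nat_nonneg hm)
    (hck.trans_le (mul_cos_pi_div_le_cos_of_slack_le (by omega) hp hk0 hx))
    (hck.trans_le (mul_cos_pi_div_le_cos_of_slack_le (by omega) hp hk0 hy))

end Slack

section SlackLift

variable {d m : ℕ} {v : Matrix (Fin d) (Fin m) ℝ} {p q : ℂ} {s t : Fin d → ℝ}

/-- The nonnegative vector `t` is a lift of the point `p`: the slacks of `p` are the combination of
the rows of `v` with coefficients `t`. If `v` is the right factor of a nonnegative factorization of
the slack matrix, the rows of the left factor are lifts of the inner vertices. -/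
structure IsSlackLift (v : Matrix (Fin d) (Fin m) ℝ) (p : ℂ) (t : Fin d → ℝ) : Prop where
  nonneg : ∀ i, 0 ≤ t i
  sum_mul_eq_slack : ∀ y, ∑ i, t i * v i y = slack p y

theorem IsSlackLift.slack_nonneg (h : IsSlackLift v p t) (hv : IsStochastic v) (y : Fin m) :
    0 ≤ slack p y := by
  rw [← h.sum_mul_eq_slack]
  exact Finset.sum_nonneg fun i _ => mul_nonneg (h.nonneg i) (hv.nonneg i y)

theorem IsSlackLift.sum_eq (h : IsSlackLift v p t) (hv : IsStochastic v) (hm : 2 ≤ m) :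
    ∑ i, t i = m := by
  rw [← sum_slack hm p]
  simp only [← h.sum_mul_eq_slack]
  rw [Finset.sum_comm]
  simp only [← Finset.mul_sum, hv.sum_eq_one, mul_one]

theorem isCompact_setOf_isSlackLift (hv : IsStochastic v) (hm : 3 ≤ m) :
    IsCompact {a : ℂ × (Fin d → ℝ) | IsSlackLift v a.1 a.2} := by
  have : NeZero m := ⟨by omega⟩
  have hclosed : IsClosed {a : ℂ × (Fin d → ℝ) | IsSlackLift v a.1 a.2} := by
    have heq : {a : ℂ × (Fin d → ℝ) | IsSlackLift v a.1 a.2} =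
        {a | ∀ i, 0 ≤ a.2 i} ∩ {a | ∀ y, ∑ i, a.2 i * v i y = slack a.1 y} :=
      Set.ext fun a => ⟨fun h => ⟨h.nonneg, h.sum_mul_eq_slack⟩, fun h => ⟨h.1, h.2⟩⟩
    simp only [heq, Set.ofPred_forall]
    refine (isClosed_iInter fun i => isClosed_le (by fun_prop) (by fun_prop)).inter
      (isClosed_iInter fun y => isClosed_eq (by fun_prop) ?_)
    exact (continuous_slack y).comp continuous_fst
  refine ((isCompact_closedBall (0 : ℂ) (1 / Real.cos (Real.pi / m))).prod
    (isCompact_Icc (a := (0 : Fin d → ℝ)) (b := fun _ => (m : ℝ)))).of_isClosed_subset hclosed ?_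
  rintro ⟨p, t⟩ (h : IsSlackLift v p t)
  refine ⟨?_, h.nonneg, fun i => ?_⟩
  · rw [mem_closedBall_zero_iff, le_div_iff₀ (cos_pi_div_nat_pos hm)]
    exact norm_mul_cos_pi_div_le_one (h.slack_nonneg hv)
  · rw [← h.sum_eq hv (by omega)]
    exact Finset.single_le_sum (fun j _ => h.nonneg j) (Finset.mem_univ i)

theorem IsSlackLift.exists_forall_slack_le (h : IsSlackLift v p t) (hv : IsStochastic v)
    (hm : 3 ≤ m) (y : Fin m) :
    ∃ q s, IsSlackLift v q s ∧ ∀ p t, IsSlackLift v p t → slack q y ≤ slack p y := by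
  obtain ⟨⟨q, s⟩, hqs, hmin⟩ := (isCompact_setOf_isSlackLift hv hm).exists_isMinOn ⟨(p, t), h⟩
    ((continuous_slack y).comp continuous_fst).continuousOn
  exact ⟨q, s, hqs, fun p t hpt => hmin (show (p, t) ∈ _ from hpt)⟩

theorem exists_pos_forall_nonneg_add_mul_sub {ι : Type*} [Finite ι] {s t : ι → ℝ}
    (hs : ∀ i, 0 ≤ s i) (h : ∀ i, s i = 0 → t i = 0) :
    ∃ ε > 0, ∀ i, 0 ≤ s i + ε * (s i - t i) := by
  have hev (i : ι) : ∀ᶠ ε : ℝ in nhdsWithin 0 (Set.Ioi 0), 0 ≤ s i + ε * (s i - t i) := by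
    rcases (hs i).eq_or_lt' with hi | hi
    · simp [hi, h i hi]
    · have hcont : Continuous fun ε : ℝ => s i + ε * (s i - t i) := by fun_prop
      refine nhdsWithin_le_nhds (hcont.continuousAt.eventually_const_le ?_)
      simpa using hi
  obtain ⟨ε, hε, hε0⟩ := ((Filter.eventually_all.mpr hev).and self_mem_nhdsWithin).exists
  exact ⟨ε, hε0, hε⟩

/-- Otherwise the slack at `y` could be decreased by moving from `p` away from `q`. -/
theorem IsSlackLift.slack_le_of_forall_slack_le (hp : IsSlackLift v p s) (hq : IsSlackLift v q t)
    (hst : ∀ i, s i = 0 → t i = 0) {y : Fin m}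
    (hmin : ∀ p' t', IsSlackLift v p' t' → slack p y ≤ slack p' y) : slack q y ≤ slack p y := by
  obtain ⟨ε, hε, hnonneg⟩ := exists_pos_forall_nonneg_add_mul_sub hp.nonneg hst
  have hlift : IsSlackLift v (p + ε • (p - q)) (fun i => s i + ε * (s i - t i)) := by
    refine ⟨hnonneg, fun z => ?_⟩
    rw [slack_add_smul_sub, ← hp.sum_mul_eq_slack, ← hq.sum_mul_eq_slack]
    simp only [add_mul, mul_assoc, sub_mul, Finset.sum_add_distrib, Finset.sum_sub_distrib,
      ← Finset.mul_sum]
  have := hmin _ _ hlift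
  rw [slack_add_smul_sub, le_add_iff_nonneg_right] at this
  exact sub_nonneg.mp (nonneg_of_mul_nonneg_right this hε)

end SlackLift

section ClassicalLowerBound

variable {d m : ℕ} {k : ℝ}

theorem isSlackLift_of_polygonCorrelation_eq {u : Fin m → Fin d → ℝ} (hu : ∀ x i, 0 ≤ u x i)
    {v : Matrix (Fin d) (Fin m) ℝ}
    (h : ∀ x y, polygonCorrelation k m x y = ∑ i, u x i * v i y) (x : Fin m) :
    IsSlackLift v (k * Complex.exp (vertexAngle x * Complex.I)) (fun i => m ^ 2 * u x i) := by
  have hm : (m : ℝ) ≠ 0 := by exact_mod_cast x.pos.ne'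
  refine ⟨fun i => mul_nonneg (by positivity) (hu x i), fun y => ?_⟩
  rw [slack_mul_exp_vertexAngle]
  simp only [mul_assoc, ← Finset.mul_sum]
  rw [← h, polygonCorrelation_apply]
  field_simp

theorem div_two_le_two_pow_of_polygonCorrelation_eq (hm : 4 ≤ m) (hk0 : 0 < k)
    (hk : Real.cos (2 * Real.pi / m) / Real.cos (Real.pi / m) ^ 2 < k)
    {u : Fin m → Fin d → ℝ} (hu : ∀ x i, 0 ≤ u x i) {v : Matrix (Fin d) (Fin m) ℝ}
    (hv : IsStochastic v) (h : ∀ x y, polygonCorrelation k m x y = ∑ i, u x i * v i y) :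
    m / 2 ≤ 2 ^ d := by
  have : NeZero m := ⟨by omega⟩
  have hinner := isSlackLift_of_polygonCorrelation_eq hu h
  choose p t hlift hmin using fun y =>
    (hinner 0).exists_forall_slack_le hv (by omega : 3 ≤ m) y
  have hslack (y : Fin m) : slack (p y) y ≤ 1 - k :=
    slack_mul_exp_vertexAngle_neg k y ▸ hmin y _ _ (hinner (-y))
  let even (j : Fin (m / 2)) : Fin m := ⟨2 * j, by omega⟩
  have hinj : Function.Injective fun j : Fin (m / 2) => {l | t (even j) l = 0} := by
    refine .of_lt_imp_ne fun i j hij hsupp => ?_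
    have hcross : slack (p (even j)) (even i) ≤ 1 - k :=
      ((hlift (even i)).slack_le_of_forall_slack_le (hlift (even j))
        (fun l => (Set.ext_iff.mp hsupp l).mp) (hmin (even i))).trans (hslack (even i))
    have hlt := cos_four_pi_div_lt_cos_vertexAngle_sub hm hk0 hk ((hlift (even j)).slack_nonneg hv)
      hcross (hslack (even j))
    have hle := cos_vertexAngle_sub_le (x := even i) (y := even j) (s := 2)
      (by simp only [even]; omega) (by simp only [even]; omega)
    refine (hlt.trans_le hle).ne ?_
    push_cast
    ring_nf
  simpa [Fintype.card_set] using Fintype.card_le_of_injective _ hinj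

theorem ClassicallyGenerates.div_two_le_two_pow {P' : Matrix (Fin d) (Fin d) ℝ}
    (h : ClassicallyGenerates P' (polygonCorrelation k m)) (hP' : IsCorrelation P') (hk0 : 0 < k)
    (hk : Real.cos (2 * Real.pi / m) / Real.cos (Real.pi / m) ^ 2 < k) : m / 2 ≤ 2 ^ d := by
  obtain hm | hm := lt_or_ge m 4
  · exact le_trans (by omega) Nat.one_le_two_pow
  obtain ⟨K, L, hK, hL, hKL⟩ := h
  refine div_two_le_two_pow_of_polygonCorrelation_eq hm hk0 hk
    (u := fun x j => ∑ i, P' i j * K i x)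
    (fun x j => Finset.sum_nonneg fun i _ => mul_nonneg (hP'.nonneg i j) (hK.nonneg i x)) hL
    fun x y => ?_
  simp only [hKL, Finset.sum_mul]
  exact Finset.sum_comm

theorem log_log_le_of_le_two_pow_two_pow {n : ℕ} (hm : 2 ≤ m) (h : m ≤ 2 ^ 2 ^ n) :
    Real.log (Real.log m) ≤ n := by
  have hlog {a : ℝ} (ha : 0 < a) {l : ℕ} (hl : a ≤ 2 ^ l) : Real.log a ≤ l :=
    calc Real.log a ≤ Real.log (2 ^ l) := Real.log_le_log ha hl
      _ = l * Real.log 2 := Real.log_pow 2 l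
      _ ≤ l := mul_le_of_le_one_right l.cast_nonneg (by linarith [Real.log_two_lt_d9])
  have hlog_m : Real.log m ≤ 2 ^ n := by
    exact_mod_cast hlog (by positivity) (l := 2 ^ n) (by exact_mod_cast h)
  exact hlog (Real.log_pos (by exact_mod_cast hm)) hlog_m

theorem ClassicallyGenerates.log_log_le_two_mul_clog {P' : Matrix (Fin d) (Fin d) ℝ}
    (h : ClassicallyGenerates P' (polygonCorrelation k m)) (hP' : IsCorrelation P') (hm : 2 ≤ m)
    (hk0 : 0 < k) (hk : Real.cos (2 * Real.pi / m) / Real.cos (Real.pi / m) ^ 2 < k) :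
    Real.log (Real.log m) ≤ 2 * Nat.clog 2 d := by
  have hd : 2 ≤ d := h.two_le_dim hP' (covariance_polygonCorrelation_ne_zero hk0.ne' hm)
  have hclog : 1 ≤ Nat.clog 2 d := Nat.clog_pos one_lt_two hd
  have hd_le : d ≤ 2 ^ Nat.clog 2 d := Nat.le_pow_clog one_lt_two d
  have hm_le : m ≤ 2 ^ 2 ^ (2 * Nat.clog 2 d) := by
    calc m ≤ 2 ^ (d + 2) := by
          have := h.div_two_le_two_pow hP' hk0 hk
          have := Nat.one_le_two_pow (n := d)
          rw [pow_add]
          omega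
      _ ≤ 2 ^ 2 ^ (Nat.clog 2 d + 1) := by gcongr <;> omega
      _ ≤ 2 ^ 2 ^ (2 * Nat.clog 2 d) := by gcongr <;> omega
  exact_mod_cast log_log_le_of_le_two_pow_two_pow hm hm_le

theorem log_log_le_classicalComplexity (hm : 2 ≤ m) (hk0 : 0 < k)
    (hk : Real.cos (2 * Real.pi / m) / Real.cos (Real.pi / m) ^ 2 < k) :
    ENNReal.ofReal (1 / 2 * Real.log (Real.log m)) ≤
      classicalComplexity (polygonCorrelation k m) := by
  refine le_iInf fun d => le_iInf fun P' => le_iInf fun hP' => le_iInf fun h => ?_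
  rw [seedSize, ← ENNReal.ofReal_natCast]
  exact ENNReal.ofReal_le_ofReal (by linarith [h.log_log_le_two_mul_clog hP' hm hk0 hk])

end ClassicalLowerBound

section Qubit

open scoped Matrix

/-- The qubit operator `p I + r (cos θ Z + sin θ X)`, with `X` and `Z` the Pauli matrices: the point
with direction `θ` and length `r` of a plane section of the Bloch ball, scaled to trace `2p`. -/
noncomputable def qubitEffect (p r θ : ℝ) : Matrix (Fin 2) (Fin 2) ℂ :=
  !![((p + r * Real.cos θ : ℝ) : ℂ), ((r * Real.sin θ : ℝ) : ℂ);
     ((r * Real.sin θ : ℝ) : ℂ), ((p - r * Real.cos θ : ℝ) : ℂ)]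

theorem qubitEffect_two_mul (p r φ : ℝ) :
    qubitEffect p r (2 * φ) = ((p - r : ℝ) : ℂ) • (1 : Matrix (Fin 2) (Fin 2) ℂ) +
      ((2 * r : ℝ) : ℂ) • Matrix.vecMulVec ![(Real.cos φ : ℂ), (Real.sin φ : ℂ)]
        (star ![(Real.cos φ : ℂ), (Real.sin φ : ℂ)]) := by
  have hsq : (Real.sin φ : ℂ) ^ 2 = 1 - (Real.cos φ : ℂ) ^ 2 := by exact_mod_cast Real.sin_sq φ
  rw [qubitEffect, Real.cos_two_mul, Real.sin_two_mul]
  ext i j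
  simp only [Matrix.add_apply, Matrix.smul_apply, Matrix.vecMulVec_apply, Pi.star_apply]
  fin_cases i <;> fin_cases j <;> simp [-Complex.ofReal_cos, -Complex.ofReal_sin]
  · ring
  · ring
  · ring
  · linear_combination (-2 * r : ℂ) * hsq

theorem posSemidef_qubitEffect {p r : ℝ} (hr : 0 ≤ r) (hrp : r ≤ p) (θ : ℝ) :
    (qubitEffect p r θ).PosSemidef := by
  rw [← mul_div_cancel₀ θ two_ne_zero, qubitEffect_two_mul]
  refine (Matrix.PosSemidef.one.smul ?_).add ((Matrix.posSemidef_vecMulVec_self_star _).smul ?_)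
  · exact_mod_cast sub_nonneg.mpr hrp
  · exact_mod_cast mul_nonneg zero_le_two hr

theorem trace_qubitEffect (p r θ : ℝ) : (qubitEffect p r θ).trace = 2 * p := by
  simp [qubitEffect, Matrix.trace_fin_two]
  ring

theorem transpose_qubitEffect (p r θ : ℝ) : (qubitEffect p r θ)ᵀ = qubitEffect p r θ := by
  ext i j
  fin_cases i <;> fin_cases j <;> rfl

theorem qubitEffect_sub_smul_one (p q r θ : ℝ) :
    qubitEffect p r θ - (q : ℂ) • (1 : Matrix (Fin 2) (Fin 2) ℂ) = qubitEffect (p - q) r θ := by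
  ext i j
  fin_cases i <;> fin_cases j <;> simp [qubitEffect] <;> ring

theorem depolarize_qubitEffect (lam p r θ : ℝ) :
    depolarize lam (qubitEffect p r θ) = qubitEffect p ((1 - lam) * r) θ := by
  rw [depolarize, trace_qubitEffect]
  ext i j
  fin_cases i <;> fin_cases j <;> simp [qubitEffect] <;> ring

theorem trace_qubitEffect_mul_qubitEffect (p r θ q s η : ℝ) :
    (qubitEffect p r θ * qubitEffect q s η).trace =
      ((2 * (p * q + r * s * Real.cos (θ - η)) : ℝ) : ℂ) := by
  rw [Real.cos_sub]
  simp [Matrix.trace_fin_two, qubitEffect]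
  ring

theorem sum_qubitEffect {ι : Type*} [Fintype ι] {φ : ι → ℝ} (hcos : ∑ i, Real.cos (φ i) = 0)
    (hsin : ∑ i, Real.sin (φ i) = 0) (p r : ℝ) :
    ∑ i, qubitEffect p r (φ i) =
      ((Fintype.card ι * p : ℝ) : ℂ) • (1 : Matrix (Fin 2) (Fin 2) ℂ) := by
  ext i j
  rw [Matrix.sum_apply]
  fin_cases i <;> fin_cases j <;>
    simp [qubitEffect, Finset.sum_add_distrib, Finset.sum_sub_distrib, ← Finset.mul_sum,
      ← Complex.ofReal_sum, hcos, hsin, -Complex.ofReal_cos, -Complex.ofReal_sin]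

end Qubit

section PolygonQubit

variable {m : ℕ} {k lam : ℝ}

theorem sum_qubitEffect_vertexAngle (hm : 2 ≤ m) (p r : ℝ) :
    ∑ x : Fin m, qubitEffect p r (vertexAngle x) =
      ((m * p : ℝ) : ℂ) • (1 : Matrix (Fin 2) (Fin 2) ℂ) := by
  rw [sum_qubitEffect (sum_cos_vertexAngle hm) (sum_sin_vertexAngle hm), Fintype.card_fin]

theorem sum_qubitEffect_pi_sub_vertexAngle (hm : 2 ≤ m) (p r : ℝ) :
    ∑ y : Fin m, qubitEffect p r (Real.pi - vertexAngle y) =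
      ((m * p : ℝ) : ℂ) • (1 : Matrix (Fin 2) (Fin 2) ℂ) := by
  rw [sum_qubitEffect, Fintype.card_fin]
  · simp only [Real.cos_pi_sub, Finset.sum_neg_distrib, sum_cos_vertexAngle hm, neg_zero]
  · simp only [Real.sin_pi_sub, sum_sin_vertexAngle hm]

theorem trace_qubitEffect_vertexAngle_mul (p r q s : ℝ) (x y : Fin m) :
    (qubitEffect p r (vertexAngle x) * qubitEffect q s (Real.pi - vertexAngle y)).trace =
      ((2 * (p * q - r * s * Real.cos (vertexAngle x + vertexAngle y)) : ℝ) : ℂ) := by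
  rw [trace_qubitEffect_mul_qubitEffect, sub_sub_eq_add_sub, Real.cos_sub_pi, mul_neg,
    sub_eq_add_neg]

theorem isUnit_smul_one {d : ℕ} {s : ℂ} (hs : s ≠ 0) :
    IsUnit (s • (1 : Matrix (Fin d) (Fin d) ℂ)) := by
  rw [← Algebra.algebraMap_eq_smul_one]
  exact hs.isUnit.map _

theorem mul_trace_mul_inv_smul {d : ℕ} {S : Matrix (Fin d) (Fin d) ℂ} {s : ℂ}
    (hS : S = s • 1) (hs : s ≠ 0) (c : ℂ) (A : Matrix (Fin d) (Fin d) ℂ) :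
    (c * (A * S⁻¹).trace) • S = (c * A.trace) • 1 := by
  have hinv : S⁻¹ = s⁻¹ • 1 := Matrix.inv_eq_right_inv (by simp [hS, hs])
  rw [hinv, hS, Matrix.mul_smul, Matrix.mul_one, Matrix.trace_smul, smul_smul, smul_eq_mul]
  congr 1
  field_simp

theorem posSemidef_qubitEffect_sub_noise {p r s : ℝ} (hr : 0 ≤ r) (hrp : r ≤ (1 - lam) * p)
    {S : Matrix (Fin 2) (Fin 2) ℂ} (hS : S = (s : ℂ) • 1) (hs : s ≠ 0) (θ : ℝ) :
    (qubitEffect p r θ -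
      ((lam : ℂ) / ((2 : ℕ) : ℂ) * (qubitEffect p r θ * S⁻¹).trace) • S).PosSemidef := by
  have hnoise : (lam : ℂ) / ((2 : ℕ) : ℂ) * (2 * p) = ((lam * p : ℝ) : ℂ) := by
    push_cast
    ring
  rw [mul_trace_mul_inv_smul hS (Complex.ofReal_ne_zero.mpr hs), trace_qubitEffect, hnoise,
    qubitEffect_sub_smul_one]
  exact posSemidef_qubitEffect hr (by linarith) θ

theorem exists_isNoisyPSDFactorization_polygonCorrelation (hk : 0 ≤ k) (hm : 2 ≤ m)
    (hlam0 : 0 ≤ lam) (hlam : lam ≤ 1 - √k) :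
    ∃ C D : Fin m → Matrix (Fin 2) (Fin 2) ℂ,
      IsNoisyPSDFactorization lam (polygonCorrelation k m) C D := by
  have hm0 : (m : ℝ) ≠ 0 := by positivity
  have hradius {p : ℝ} (hp : 0 ≤ p) : √k * p ≤ (1 - lam) * p := by gcongr; linarith
  have hpsd {p : ℝ} (hp : 0 ≤ p) (θ : ℝ) : (qubitEffect p (√k * p) θ).PosSemidef :=
    posSemidef_qubitEffect (by positivity) (mul_le_of_le_one_left hp (by linarith)) θ
  have hC := sum_qubitEffect_vertexAngle hm (1 / m) (√k * (1 / m))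
  have hD := sum_qubitEffect_pi_sub_vertexAngle hm (1 / (2 * m)) (√k * (1 / (2 * m)))
  refine ⟨_, _, fun x => hpsd (by positivity) _, fun y => hpsd (by positivity) _, fun x y => ?_,
    ?_, ?_,
    fun x => posSemidef_qubitEffect_sub_noise (by positivity) (hradius (by positivity)) hC
      (by positivity) _,
    fun y => posSemidef_qubitEffect_sub_noise (by positivity) (hradius (by positivity)) hD
      (by positivity) _⟩
  · rw [trace_qubitEffect_vertexAngle_mul, polygonCorrelation_apply, mul_mul_mul_comm,
      Real.mul_self_sqrt hk]
    congr 1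
    field_simp
  · exact hC ▸ isUnit_smul_one (by simp [hm0])
  · exact hD ▸ isUnit_smul_one (by simp [hm0])

end PolygonQubit

section MaximallyEntangled

open scoped Matrix

variable {d : ℕ}

/-- The maximally entangled state `|ω⟩⟨ω|` of two `d`-dimensional systems, where
`ω = d^(-1/2) ∑ i, e_i ⊗ e_i`. -/
noncomputable def maximallyEntangledState (d : ℕ) : Matrix (Fin d × Fin d) (Fin d × Fin d) ℂ :=
  (d : ℂ)⁻¹ • Matrix.vecMulVec (fun p => if p.1 = p.2 then 1 else 0)
    (star fun p => if p.1 = p.2 then 1 else 0)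

theorem isBipartiteState_maximallyEntangledState (hd : d ≠ 0) :
    IsBipartiteState (maximallyEntangledState d) where
  posSemidef := (Matrix.posSemidef_vecMulVec_self_star _).smul (by positivity)
  trace_eq_one := by
    simp [maximallyEntangledState, Matrix.trace, Fintype.sum_prod_type, Matrix.vecMulVec_apply, hd]

theorem trace_kronecker_mul_maximallyEntangledState (A B : Matrix (Fin d) (Fin d) ℂ) :
    ((A ⊗ₖ B) * maximallyEntangledState d).trace = (d : ℂ)⁻¹ * (A * Bᵀ).trace := by
  simp [maximallyEntangledState, Matrix.trace, Matrix.mul_apply, Fintype.sum_prod_type,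
    Matrix.vecMulVec_apply, Finset.mul_sum]

end MaximallyEntangled

section QuantumAdvantage

variable {m : ℕ} {k lam : ℝ}

theorem quantumGenerates_polygonCorrelation (hk : 0 < k) (hm : 2 ≤ m) (hlam : lam ≤ 1 - √k) :
    QuantumGenerates lam (maximallyEntangledState 2) (polygonCorrelation k m) := by
  have hm0 : (m : ℝ) ≠ 0 := by positivity
  have hsqrt : 0 < √k := Real.sqrt_pos.mpr hk
  have hlam1 : 0 < 1 - lam := by linarith
  set r : ℝ := √k / (1 - lam) * (1 / m) with hr
  have hr0 : 0 ≤ r := by positivity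
  have hr1 : r ≤ 1 / m :=
    mul_le_of_le_one_left (by positivity) ((div_le_one hlam1).mpr (by linarith))
  have hnoise : (1 - lam) * r = √k * (1 / m) := by
    rw [hr]
    field_simp
  have hone : ((m * (1 / m) : ℝ) : ℂ) = 1 := by rw [mul_one_div_cancel hm0, Complex.ofReal_one]
  refine ⟨fun x => qubitEffect (1 / m) r (vertexAngle x),
    fun y => qubitEffect (1 / m) r (Real.pi - vertexAngle y),
    ⟨fun x => posSemidef_qubitEffect hr0 hr1 _, ?_⟩,
    ⟨fun y => posSemidef_qubitEffect hr0 hr1 _, ?_⟩, fun x y => ?_⟩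
  · rw [sum_qubitEffect_vertexAngle hm, hone, one_smul]
  · rw [sum_qubitEffect_pi_sub_vertexAngle hm, hone, one_smul]
  · rw [trace_kronecker_mul_noisyState, depolarize_qubitEffect, depolarize_qubitEffect, hnoise,
      trace_kronecker_mul_maximallyEntangledState, transpose_qubitEffect,
      trace_qubitEffect_vertexAngle_mul, polygonCorrelation_apply, mul_mul_mul_comm,
      Real.mul_self_sqrt hk.le]
    push_cast
    ring

theorem reachable_polygonCorrelation (hk : 0 < k) (hm : 2 ≤ m) (hlam : lam ≤ 1 - √k) :
    Reachable lam (polygonCorrelation k m) :=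
  ⟨2, maximallyEntangledState 2, isBipartiteState_maximallyEntangledState two_ne_zero,
    quantumGenerates_polygonCorrelation hk hm hlam⟩

theorem quantumCost_polygonCorrelation (hk : 0 < k) (hm : 2 ≤ m) (hlam : lam ≤ 1 - √k) :
    quantumCost lam (polygonCorrelation k m) = 1 := by
  apply le_antisymm
  · calc quantumCost lam (polygonCorrelation k m) ≤ seedSize 2 :=
          iInf_le_of_le 2 <| iInf_le_of_le (maximallyEntangledState 2) <|
            iInf_le_of_le (isBipartiteState_maximallyEntangledState two_ne_zero) <|
            iInf_le _ (quantumGenerates_polygonCorrelation hk hm hlam)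
      _ = 1 := by simp [seedSize, Nat.clog_of_two_le]
  · exact one_le_quantumCost (covariance_polygonCorrelation_ne_zero hk.ne' hm) lam

theorem quantumAdvantage_polygonCorrelation (hk : 0 < k) (hm : 2 ≤ m) (hlam : lam ≤ 1 - √k) :
    quantumAdvantage lam (polygonCorrelation k m) =
      classicalComplexity (polygonCorrelation k m) := by
  rw [quantumAdvantage, quantumCost_polygonCorrelation hk hm hlam, div_one]

theorem not_reachable_polygonCorrelation (hm : 2 ≤ m) (hlam : 1 - √k < lam) (hlam1 : lam ≤ 1) :
    ¬ Reachable lam (polygonCorrelation k m) := fun h => by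
  linarith [sqrt_le_of_reachable_polygonCorrelation hm hlam1 h]

end QuantumAdvantage

end CorrelationGeneration

theorem theorem3 :
    (∀ (k : ℝ), 0 < k → k < 1 → ∀ (m : ℕ), 2 ≤ m →
      IsCorrelation (polygonCorrelation k m) ∧
      ∀ (lam : ℝ), 0 ≤ lam → lam ≤ 1 - Real.sqrt k →
        (∃ C D : Fin m → Matrix (Fin 2) (Fin 2) ℂ,
          IsNoisyPSDFactorization lam (polygonCorrelation k m) C D) ∧
        Reachable lam (polygonCorrelation k m) ∧
        quantumAdvantage lam (polygonCorrelation k m) =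
          classicalComplexity (polygonCorrelation k m)) ∧
    (∃ c : ℝ, 0 < c ∧ ∀ (m : ℕ), 3 ≤ m → ∀ (k : ℝ), 0 < k → k < 1 →
      Real.cos (2 * Real.pi / m) / Real.cos (Real.pi / m) ^ 2 < k →
      ∀ (lam : ℝ), 0 ≤ lam → lam ≤ 1 - Real.sqrt k →
        ENNReal.ofReal (c * Real.log (Real.log m)) ≤
          quantumAdvantage lam (polygonCorrelation k m)) ∧
    (∀ (k : ℝ), 0 < k → k < 1 → ∀ (m : ℕ), 2 ≤ m →
      ∀ (lam : ℝ), 1 - Real.sqrt k < lam → lam ≤ 1 →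
        ¬ Reachable lam (polygonCorrelation k m) ∧
        quantumAdvantage lam (polygonCorrelation k m) = 0) := by
  refine ⟨fun k hk0 hk1 m hm => ?_, ?_, fun k _ _ m hm lam hlam hlam1 => ?_⟩
  · exact ⟨isCorrelation_polygonCorrelation hk0.le hk1.le hm, fun lam hlam0 hlam =>
      ⟨exists_isNoisyPSDFactorization_polygonCorrelation hk0.le hm hlam0 hlam,
        reachable_polygonCorrelation hk0 hm hlam,
        quantumAdvantage_polygonCorrelation hk0 hm hlam⟩⟩
  · refine ⟨1 / 2, by norm_num, fun m hm k hk0 _ hk lam _ hlam => ?_⟩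
    have hm2 : 2 ≤ m := by omega
    rw [quantumAdvantage_polygonCorrelation hk0 hm2 hlam]
    exact log_log_le_classicalComplexity hm2 hk0 hk
  · have hnot := not_reachable_polygonCorrelation hm hlam hlam1
    exact ⟨hnot, quantumAdvantage_eq_zero hnot⟩
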